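/- Consider an instance $B$ of Pandora's problem with non-obligatory inspection (PNOI): there are $n$ boxes; box $i$ has an opening cost $c_i\ge 0$ and contains a value $v_i\ge 0$; the values are independent with known bounded distributions. A policy adaptively opens boxes, paying the cost of each and observing its value, and ends either by taking the largest value revealed so far ($0$ if there is none) or by taking an unopened box uninspected; its payoff is the value taken minus the costs paid. Let $\mathrm{OPT}$ be the optimal expected payoff. Let $\varepsilon>0$ and $\theta\in[\mathrm{OPT}/\varepsilon,\,2\,\mathrm{OPT}/\varepsilon]$. For each $i$ let $\tau_i$ be a solution of $\mathbb{E}[(v_i-\tau_i)_+]=c_i$, and put $\kappa_i=\min\{v_i,\tau_i\}$ and $F(x)=\sum_{i=1}^n\mathbb{E}[(\kappa_i-x)_+]$. Let $\mathrm{MaxV}$ be the largest value in the supports of the distributions, and let $\theta=\theta_1<\theta_2<\dots<\theta_m=\mathrm{MaxV}$, for some $m\ge 1$ (for instance $m=\lceil 2/\varepsilon\rceil$, i.e. $O(1/\varepsilon)$ points), be such that $F(\theta_j)-F(\theta_{j+1})<\varepsilon\cdot\mathrm{OPT}$ for all $1\le j<m$. Let $D^L(x)$ be the smallest $\theta_j\ge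 x$ if $x\in[\theta,\mathrm{MaxV}]$, and $D^L(x)=x$ if $x<\theta$. The L-PNOI instance $B^L$ is the following sequential decision process. Its state is a real number $I$, initially $0$. Opening an unopened box $i$ in state $I$ gives the marginal payoff $\max\{I,v_i\}-I-c_i$ and moves to the state $D^L(\max\{I,v_i\})$; taking an unopened box $i$ uninspected gives the marginal payoff $\mathbb{E}[v_i]-I$ and ends the process; the process may be ended at any time with marginal payoff $0$. Each box is opened at most once. Let $\mathrm{OPT}^L$ be the optimal expected sum of marginal payoffs over all policies. Then there is an absolute constant $C>0$, independent of $n$, $B$, $\varepsilon$, $\theta$ and the discretization points, such that $$\mathrm{OPT}\;\ge\;\mathrm{OPT}^L\;\ge\;(1-C\varepsilon)\cdot\mathrm{OPT}.$$ -/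

import Mathlib

open MeasureTheory

/-- An instance of Pandora's problem with non-obligatory inspection on `n` boxes: box `i` has an
opening cost `cost i ≥ 0` and an independent value with law `dist i`, which is non-negative and
bounded (so that the largest value in the supports exists). -/
structure PNOI (n : ℕ) where
  cost : Fin n → ℝ
  dist : Fin n → Measure ℝ
  cost_nonneg : ∀ i, 0 ≤ cost i
  isProb : ∀ i, IsProbabilityMeasure (dist i)
  value_nonneg : ∀ i, ∀ᵐ v ∂dist i, 0 ≤ v
  value_bounded : ∃ M : ℝ, ∀ i, ∀ᵐ v ∂dist i, v ≤ M

attribute [instance] PNOI.isProb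

/-- The actions: `probe i` opens box `i`; `take i` takes box `i` without opening it and ends the
process; `quit` takes the largest revealed value (`0` if there is none) and ends the process. -/
inductive BoxAction (n : ℕ) where
  | probe (i : Fin n) : BoxAction n
  | take (i : Fin n) : BoxAction n
  | quit : BoxAction n

instance (n : ℕ) : MeasurableSpace (BoxAction n) := ⊤

/-- A deterministic adaptive policy chooses the next action as a measurable function of the history.
The history lists, most recent first, the boxes opened so far, each with the number observed on
opening it. A box that has been opened can be neither opened again nor taken uninspected. -/
structure BoxPolicy (n : ℕ) where
  act : List (Fin n × ℝ) → BoxAction n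
  measurable_act : ∀ t : ℕ, Measurable fun h : Fin t → Fin n × ℝ => act (List.ofFn h)
  legal : ∀ (h : List (Fin n × ℝ)) (i : Fin n), i ∈ h.map Prod.fst →
    act h ≠ BoxAction.probe i ∧ act h ≠ BoxAction.take i

namespace PNOI

variable {n : ℕ} (B : PNOI n)

/-- The joint law of the values: they are independent. -/
noncomputable def law : Measure (Fin n → ℝ) := Measure.pi B.dist

/-- The expected value in box `i`. -/
noncomputable def mean (i : Fin n) : ℝ := ∫ v, v ∂B.dist i

/-- The largest value in the supports of the value distributions (`0` if there is no box). -/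
noncomputable def maxV : ℝ := sSup (⋃ i, (B.dist i).support)

/-- The largest value revealed in a history, `0` if there is none. -/
noncomputable def bestSeen (h : List (Fin n × ℝ)) : ℝ := (h.map Prod.snd).foldr max 0

/-- The total opening cost incurred in a history. -/
noncomputable def spent (h : List (Fin n × ℝ)) : ℝ := (h.map fun q => B.cost q.1).sum

/-- The payoff of `π` on the values `ω` when continued from the history `h` for at most `k` more
openings. At each opening the policy observes the value in the box. Once all boxes have been opened,
`quit` is the only legal action, so that no policy is cut short when `k = n` and `h = []`. -/
noncomputable def payoffFrom (π : BoxPolicy n) (ω : Fin n → ℝ) : ℕ → List (Fin n × ℝ) → ℝ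
  | 0, h => bestSeen h - B.spent h
  | k + 1, h =>
    match π.act h with
    | BoxAction.quit => bestSeen h - B.spent h
    | BoxAction.take i => ω i - B.spent h
    | BoxAction.probe i => payoffFrom π ω k ((i, ω i) :: h)

/-- The expected payoff of the policy `π` on the instance `B`. -/
noncomputable def expPayoff (π : BoxPolicy n) : ℝ := ∫ ω, B.payoffFrom π ω n [] ∂B.law

/-- The optimal expected payoff of `B`. -/
noncomputable def opt : ℝ := sSup (Set.range B.expPayoff)

/-- `t` is an index of box `i`: it solves `𝔼[(vᵢ - t)₊] = cᵢ`. (It is unique if `cᵢ > 0`; if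
`cᵢ = 0`, then `min vᵢ t = vᵢ` almost surely for every solution `t`.) -/
def IsIndex (i : Fin n) (t : ℝ) : Prop := ∫ v, max (v - t) 0 ∂B.dist i = B.cost i

/-- `F(S, x) = ∑_{i ∈ S} 𝔼[(κᵢ - x)₊]` with `κᵢ = min vᵢ τᵢ`, for given indices `τ`. -/
noncomputable def surplus (τ : Fin n → ℝ) (S : Finset (Fin n)) (x : ℝ) : ℝ :=
  ∑ i ∈ S, ∫ v, max (min v (τ i) - x) 0 ∂B.dist i

/-- `p 1, …, p m` are discretization points for the large values: they increase strictly from `θ`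
to the largest value, and `F([n], ·)` drops by less than `ε · OPT` from each to the next. -/
structure IsDiscretization (τ : Fin n → ℝ) (ε θ : ℝ) (m : ℕ) (p : ℕ → ℝ) : Prop where
  one_le : 1 ≤ m
  first : p 1 = θ
  last : p m = B.maxV
  strictMono : ∀ j, 1 ≤ j → j < m → p j < p (j + 1)
  drop_lt : ∀ j, 1 ≤ j → j < m →
    B.surplus τ Finset.univ (p j) - B.surplus τ Finset.univ (p (j + 1)) < ε * B.opt

open Classical in
/-- The discretization function: a number between `p 1` and `p m` is rounded up to the nearest of
`p 1, …, p m`; numbers below `p 1` are kept. (Numbers above `p m` are irrelevant and kept.) -/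
noncomputable def roundUp (m : ℕ) (p : ℕ → ℝ) (x : ℝ) : ℝ :=
  if p 1 ≤ x ∧ x ≤ p m then sInf {t : ℝ | ∃ j, 1 ≤ j ∧ j ≤ m ∧ t = p j ∧ x ≤ t} else x

/-- State transition of the L-PNOI instance with discretization function `D`. -/
noncomputable def stepL (D : ℝ → ℝ) (ω : Fin n → ℝ) (I : ℝ) : BoxAction n → ℝ
  | BoxAction.probe i => D (max I (ω i))
  | BoxAction.take i => max I (B.mean i)
  | BoxAction.quit => I

/-- Marginal payoff of the L-PNOI instance, computed from the current state and the raw value. -/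
noncomputable def gainL (ω : Fin n → ℝ) (I : ℝ) : BoxAction n → ℝ
  | BoxAction.probe i => max I (ω i) - I - B.cost i
  | BoxAction.take i => B.mean i - I
  | BoxAction.quit => 0

/-- The sum of the marginal payoffs that `π` collects in the L-PNOI instance from the state `I` and
the history `h` on, in at most `k` more actions. At each opening the policy observes the new state.
The actions `take i` and `quit` end the process. -/
noncomputable def payoffFromL (D : ℝ → ℝ) (π : BoxPolicy n) (ω : Fin n → ℝ) :
    ℕ → ℝ → List (Fin n × ℝ) → ℝ
  | 0, _, _ => 0
  | k + 1, I, h =>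
    B.gainL ω I (π.act h) +
      match π.act h with
      | BoxAction.probe i =>
        payoffFromL D π ω k (B.stepL D ω I (BoxAction.probe i))
          ((i, B.stepL D ω I (BoxAction.probe i)) :: h)
      | BoxAction.take _ => 0
      | BoxAction.quit => 0

/-- The expected payoff of `π` on the L-PNOI instance, from the initial state `0`. After `n`
openings `quit` is the only legal action and has payoff `0`, so `n` actions are enough. -/
noncomputable def expPayoffL (D : ℝ → ℝ) (π : BoxPolicy n) : ℝ :=
  ∫ ω, B.payoffFromL D π ω n 0 [] ∂B.law

/-- The optimal expected payoff of the L-PNOI instance with discretization function `D`. -/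
noncomputable def optL (D : ℝ → ℝ) : ℝ := sSup (Set.range (B.expPayoffL D))

end PNOI

/-! Both optima are values of one Bellman recursion `value D`, with `D` the identity for OPT and `D
= roundUp` for OPT^L (`opt_eq_value`, `optL_eq_value`). The rest compares two value functions.

Upper bound: every marginal payoff, `max I v - I` or `mean - I`, decreases in the state, and
rounding only raises the state (`value_le_value_id`).

Lower bound: let `x ≥ θ`, with the boxes of `S` unopened. As `θ ≥ OPT ≥ 𝔼[vᵢ]`, taking a box
uninspected gains nothing, and the remaining gain is at most `F(S, x)` (`value_le_surplus`).
Rounding `x` up to `p j` lowers the surplus by at most `ε · OPT`. In the state `p j`, which rounding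
fixes, opening boxes of index above `p j` until the state changes earns at least `Q · F(S, p j)`,
where `Q` is the probability that no `κᵢ` with `i ∈ S` exceeds `p j`
(`lowProb_mul_surplus_le_value`).

To control `Q` and `F`, consider opening boxes in the original problem until a value above `θ`
appears. This shows `θ (1 - Q) + Q · F(θ) ≤ OPT`, with `Q` now taken at `θ` over all boxes
(`le_add_value`). Hence `Q ≥ 1 - ε`, and `F(θ) ≤ 2 OPT` when `ε ≤ 1/2`; both bounds pass to larger
thresholds and fewer boxes. The loss from a large state on is thus at most `(2 + 1) ε · OPT`. Below
`θ` nothing is rounded, so this loss is incurred only once (`value_id_le_value_add`). -/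

instance (n : ℕ) : MeasurableSingletonClass (BoxAction n) := ⟨fun _ => trivial⟩

theorem BoxAction.range_eq (n : ℕ) :
    (Set.range BoxAction.probe ∪ Set.range BoxAction.take ∪ {BoxAction.quit} :
      Set (BoxAction n)) = Set.univ := by
  ext a
  cases a <;> simp

instance (n : ℕ) : Countable (BoxAction n) := by
  rw [← Set.countable_univ_iff, ← BoxAction.range_eq]
  exact ((Set.countable_range _).union (Set.countable_range _)).union (Set.countable_singleton _)

/-- A function that picks one of countably many measurable functions measurably is measurable. -/
theorem Measurable.of_countable_choice {α β ι : Type*} [MeasurableSpace α] [MeasurableSpace β]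
    [MeasurableSpace ι] [Countable ι] [MeasurableSingletonClass ι] {f : ι → α → β} {a : α → ι}
    (hf : ∀ i, Measurable (f i)) (ha : Measurable a) : Measurable fun x => f (a x) x := by
  have h : Measurable fun q : α × ι => f q.2 q.1 := measurable_from_prod_countable_left hf
  exact h.comp (measurable_id.prodMk ha)

/-! ### Bounds and the Bellman value function. -/

namespace PNOI

variable {n : ℕ} (B : PNOI n)

instance : IsProbabilityMeasure B.law := by unfold law; infer_instance

theorem bddAbove_support : BddAbove (⋃ i, (B.dist i).support) := by
  obtain ⟨M, hM⟩ := B.value_bounded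
  refine ⟨M, ?_⟩
  rintro x hx
  obtain ⟨i, hi⟩ := Set.mem_iUnion.1 hx
  exact Measure.support_subset_of_isClosed isClosed_Iic (hM i) hi

theorem ae_le_maxV (i : Fin n) : ∀ᵐ v ∂B.dist i, v ≤ B.maxV := by
  filter_upwards [Measure.support_mem_ae (μ := B.dist i)] with v hv
  exact le_csSup B.bddAbove_support (Set.mem_iUnion.2 ⟨i, hv⟩)

theorem ae_mem_Icc (i : Fin n) : ∀ᵐ v ∂B.dist i, v ∈ Set.Icc 0 B.maxV := by
  filter_upwards [B.value_nonneg i, B.ae_le_maxV i] with v h1 h2 using ⟨h1, h2⟩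

theorem maxV_nonneg : 0 ≤ B.maxV := by
  rcases isEmpty_or_nonempty (Fin n) with h | ⟨⟨i⟩⟩
  · simp [maxV]
  · obtain ⟨v, hv⟩ := (B.ae_mem_Icc i).exists
    exact hv.1.trans hv.2

theorem integrable_of_bound {i : Fin n} {f : ℝ → ℝ} (hf : Measurable f) {C : ℝ}
    (h : ∀ v ∈ Set.Icc 0 B.maxV, |f v| ≤ C) : Integrable f (B.dist i) := by
  refine Integrable.of_bound hf.aestronglyMeasurable C ?_
  filter_upwards [B.ae_mem_Icc i] with v hv using h v hv

theorem integrable_value (i : Fin n) : Integrable (fun v : ℝ => v) (B.dist i) :=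
  B.integrable_of_bound measurable_id (C := B.maxV) fun v hv => by
    rw [abs_of_nonneg hv.1]; exact hv.2

theorem mean_mem_Icc (i : Fin n) : B.mean i ∈ Set.Icc 0 B.maxV := by
  refine ⟨integral_nonneg_of_ae (B.value_nonneg i), ?_⟩
  have := integral_mono_ae (B.integrable_value i) (integrable_const B.maxV) (B.ae_le_maxV i)
  simpa [mean] using this

/-- A bound for the absolute value of a single marginal payoff. -/
noncomputable def gainBound : ℝ := B.maxV + ∑ i, B.cost i

theorem cost_le_sum (i : Fin n) : B.cost i ≤ ∑ i, B.cost i :=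
  Finset.single_le_sum (fun j _ => B.cost_nonneg j) (Finset.mem_univ i)

theorem gainBound_nonneg : 0 ≤ B.gainBound :=
  add_nonneg B.maxV_nonneg (Finset.sum_nonneg fun j _ => B.cost_nonneg j)

theorem abs_sub_le_gainBound {x y : ℝ} (hx : x ∈ Set.Icc 0 B.maxV) (hy : y ∈ Set.Icc 0 B.maxV) :
    |x - y| ≤ B.gainBound := by
  have : 0 ≤ ∑ i, B.cost i := Finset.sum_nonneg fun j _ => B.cost_nonneg j
  unfold gainBound
  rw [abs_le]
  constructor <;> linarith [hx.1, hx.2, hy.1, hy.2]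

theorem max_mem_Icc {x y : ℝ} (hx : x ∈ Set.Icc 0 B.maxV) (hy : y ∈ Set.Icc 0 B.maxV) :
    max x y ∈ Set.Icc 0 B.maxV :=
  ⟨hx.1.trans (le_max_left _ _), max_le hx.2 hy.2⟩

theorem abs_probe_le_gainBound {x y : ℝ} (hx : x ∈ Set.Icc 0 B.maxV)
    (hy : y ∈ Set.Icc 0 B.maxV) (i : Fin n) : |max x y - x - B.cost i| ≤ B.gainBound := by
  have h1 := B.cost_le_sum i
  have h2 := B.cost_nonneg i
  have h3 := (B.max_mem_Icc hx hy).2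
  have h4 := le_max_left x y
  unfold gainBound
  rw [abs_le]
  constructor <;> linarith [hx.1, hx.2, hy.1, hy.2]

/-- A sequential process on the boxes of `B` whose state is the best value so far, passed through
`next` after each opening. Opening a box shows `obs` of the state and the value; taking box `i`
uninspected pays `prize i`; the state can be recovered from the history by `stateOf`. -/
structure BoxGame where
  next : ℝ → ℝ
  obs : ℝ → ℝ → ℝ
  prize : Fin n → ℝ → ℝ
  stateOf : List (Fin n × ℝ) → ℝ
  measurable_next : Measurable next
  measurable_obs : Measurable (Function.uncurry obs)
  measurable_prize : ∀ i, Measurable (prize i)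
  measurable_stateOf : ∀ t : ℕ, Measurable fun h : Fin t → Fin n × ℝ => stateOf (List.ofFn h)
  next_mem : ∀ x ∈ Set.Icc 0 B.maxV, next x ∈ Set.Icc 0 B.maxV
  prize_mem : ∀ i, ∀ᵐ v ∂B.dist i, prize i v ∈ Set.Icc 0 B.maxV
  integral_prize : ∀ i, ∫ v, prize i v ∂B.dist i = B.mean i
  stateOf_nil : stateOf [] = 0
  stateOf_cons : ∀ h i v, stateOf ((i, obs (stateOf h) v) :: h) = next (max (stateOf h) v)

/-- The legal actions when the boxes in `S` are unopened. -/
noncomputable def legalActions (S : Finset (Fin n)) : Finset (BoxAction n) :=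
  open Classical in
  insert BoxAction.quit (S.image BoxAction.take ∪ S.image BoxAction.probe)

theorem quit_mem_legalActions (S : Finset (Fin n)) : BoxAction.quit ∈ legalActions S := by
  simp [legalActions]

theorem take_mem_legalActions {S : Finset (Fin n)} {i : Fin n} :
    BoxAction.take i ∈ legalActions S ↔ i ∈ S := by
  simp [legalActions]

theorem probe_mem_legalActions {S : Finset (Fin n)} {i : Fin n} :
    BoxAction.probe i ∈ legalActions S ↔ i ∈ S := by
  simp [legalActions]

theorem legalActions_nonempty (S : Finset (Fin n)) : (legalActions S).Nonempty :=
  ⟨_, quit_mem_legalActions S⟩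

/-- The expected marginal payoff of an action, followed by the continuation value `U`. -/
noncomputable def actionValue (D : ℝ → ℝ) (U : Finset (Fin n) → ℝ → ℝ) (S : Finset (Fin n))
    (I : ℝ) : BoxAction n → ℝ
  | BoxAction.quit => 0
  | BoxAction.take i => B.mean i - I
  | BoxAction.probe i =>
    ∫ v, (max I v - I - B.cost i + U (S.erase i) (D (max I v))) ∂B.dist i

/-- The value function of the process with transition `D`: the optimal expected sum of marginal
payoffs in at most `k` actions from the state `I`, when the boxes in `S` are unopened. -/
noncomputable def value (D : ℝ → ℝ) : ℕ → Finset (Fin n) → ℝ → ℝ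
  | 0 => fun _ _ => 0
  | k + 1 => fun S I =>
    (legalActions S).sup' (legalActions_nonempty S) (B.actionValue D (value D k) S I)

theorem actionValue_le_value (D : ℝ → ℝ) (k : ℕ) (S : Finset (Fin n)) (I : ℝ) {a : BoxAction n}
    (ha : a ∈ legalActions S) : B.actionValue D (B.value D k) S I a ≤ B.value D (k + 1) S I :=
  Finset.le_sup' (B.actionValue D (B.value D k) S I) ha

theorem exists_value_eq (D : ℝ → ℝ) (k : ℕ) (S : Finset (Fin n)) (I : ℝ) :
    ∃ a ∈ legalActions S, B.actionValue D (B.value D k) S I a = B.value D (k + 1) S I := by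
  obtain ⟨a, ha, h⟩ := Finset.exists_mem_eq_sup' (legalActions_nonempty S)
    (B.actionValue D (B.value D k) S I)
  exact ⟨a, ha, h.symm⟩

theorem value_nonneg' (D : ℝ → ℝ) (k : ℕ) (S : Finset (Fin n)) (I : ℝ) :
    0 ≤ B.value D k S I := by
  cases k with
  | zero => exact le_rfl
  | succ k => exact B.actionValue_le_value D k S I (quit_mem_legalActions S)

theorem value_succ_le {D : ℝ → ℝ} {k : ℕ} {S : Finset (Fin n)} {I b : ℝ} (h0 : 0 ≤ b)
    (htake : ∀ i ∈ S, B.mean i - I ≤ b)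
    (hprobe : ∀ i ∈ S, ∫ v, (max I v - I - B.cost i + B.value D k (S.erase i) (D (max I v)))
      ∂B.dist i ≤ b) : B.value D (k + 1) S I ≤ b := by
  refine Finset.sup'_le (legalActions_nonempty S) _ fun a ha => ?_
  cases a with
  | quit => exact h0
  | take i => exact htake i (take_mem_legalActions.1 ha)
  | probe i => exact hprobe i (probe_mem_legalActions.1 ha)

theorem measurable_actionValue {D : ℝ → ℝ} (hD : Measurable D) {U : Finset (Fin n) → ℝ → ℝ}
    (hU : ∀ S, Measurable (U S)) (S : Finset (Fin n)) (a : BoxAction n) :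
    Measurable fun I => B.actionValue D U S I a := by
  cases a with
  | quit => exact measurable_const
  | take i => exact measurable_const.sub measurable_id
  | probe i =>
    refine StronglyMeasurable.measurable ?_
    refine StronglyMeasurable.integral_prod_right
      (f := fun I v => max I v - I - B.cost i + U (S.erase i) (D (max I v))) ?_
    have := hU (S.erase i)
    refine Measurable.stronglyMeasurable ?_
    unfold Function.uncurry
    fun_prop

theorem measurable_value {D : ℝ → ℝ} (hD : Measurable D) (k : ℕ) (S : Finset (Fin n)) :
    Measurable (B.value D k S) := by
  induction k generalizing S with
  | zero => exact measurable_const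
  | succ k ih =>
    have := Finset.measurable_sup' (legalActions_nonempty S)
      (f := fun a I => B.actionValue D (B.value D k) S I a)
      fun a _ => B.measurable_actionValue hD ih S a
    convert this using 1
    ext I
    simp [value]

theorem value_le_gainBound {D : ℝ → ℝ}
    (hmem : ∀ x ∈ Set.Icc 0 B.maxV, D x ∈ Set.Icc 0 B.maxV) (k : ℕ) (S : Finset (Fin n)) {I : ℝ}
    (hI : I ∈ Set.Icc 0 B.maxV) : B.value D k S I ≤ k * B.gainBound := by
  induction k generalizing S I with
  | zero => simp [value]
  | succ k ih =>
    have hb := B.gainBound_nonneg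
    have hk : 0 ≤ (k : ℝ) * B.gainBound := by positivity
    push_cast
    refine B.value_succ_le (by linarith) (fun i _ => ?_) fun i _ => ?_
    · linarith [le_abs_self (B.mean i - I), B.abs_sub_le_gainBound (B.mean_mem_Icc i) hI]
    · have hle : ∀ v ∈ Set.Icc 0 B.maxV,
          max I v - I - B.cost i + B.value D k (S.erase i) (D (max I v)) ≤
            (k + 1) * B.gainBound := fun v hv => by
        have h1 := ih (S.erase i) (hmem _ (B.max_mem_Icc hI hv))
        linarith [(le_abs_self _).trans (B.abs_probe_le_gainBound hI hv i)]
      -- A non-integrable integrand has integral 0 by convention, which also respects the bound.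
      by_cases hint : Integrable (fun v => max I v - I - B.cost i +
          B.value D k (S.erase i) (D (max I v))) (B.dist i)
      · have := integral_mono_ae hint (integrable_const ((k + 1) * B.gainBound))
          ((B.ae_mem_Icc i).mono hle)
        simpa using this
      · rw [integral_undef hint]
        positivity

theorem integrable_probe {D : ℝ → ℝ} (hD : Measurable D)
    (hmem : ∀ x ∈ Set.Icc 0 B.maxV, D x ∈ Set.Icc 0 B.maxV) (k : ℕ) (S : Finset (Fin n)) {I : ℝ}
    (hI : I ∈ Set.Icc 0 B.maxV) (i : Fin n) :
    Integrable (fun v => max I v - I - B.cost i + B.value D k S (D (max I v))) (B.dist i) := by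
  have := B.measurable_value hD k S
  refine B.integrable_of_bound (C := B.gainBound + k * B.gainBound) (by fun_prop) fun v hv => ?_
  refine (abs_add_le _ _).trans (add_le_add (B.abs_probe_le_gainBound hI hv i) ?_)
  rw [abs_of_nonneg (B.value_nonneg' D k S _)]
  exact B.value_le_gainBound hmem k S (hmem _ (B.max_mem_Icc hI hv))

end PNOI

/-! ### Independence, and policies against the value function. -/

namespace PNOI

variable {n : ℕ} (B : PNOI n)

/-- Redrawing one coordinate independently does not change the joint law of the values. -/
theorem measurePreserving_update (i : Fin n) :
    MeasurePreserving (fun q : ℝ × (Fin n → ℝ) => Function.update q.2 i q.1)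
      ((B.dist i).prod B.law) B.law := by
  have hm : Measurable fun q : ℝ × (Fin n → ℝ) => Function.update q.2 i q.1 := by
    refine measurable_pi_lambda _ fun j => ?_
    by_cases h : j = i
    · subst h; simpa using measurable_fst
    · simpa [h, Function.comp_def] using (measurable_pi_apply j).comp measurable_snd
  refine ⟨hm, Eq.symm (Measure.pi_eq fun s hs => ?_)⟩
  rw [Measure.map_apply hm (MeasurableSet.univ_pi hs)]
  -- The redrawn value must lie in `s i`, while the overwritten coordinate is unconstrained.
  have : (fun q : ℝ × (Fin n → ℝ) => Function.update q.2 i q.1) ⁻¹' Set.univ.pi s =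
      s i ×ˢ Set.univ.pi (Function.update s i Set.univ) := by
    ext ⟨v, ω⟩
    simp only [Set.mem_preimage, Set.mem_univ_pi, Set.mem_prod]
    constructor
    · intro h
      refine ⟨by simpa using h i, fun j => ?_⟩
      by_cases hj : j = i
      · subst hj; simp
      · simpa [hj] using h j
    · rintro ⟨h1, h2⟩ j
      by_cases hj : j = i
      · subst hj; simpa using h1
      · simpa [hj] using h2 j
  rw [this, Measure.prod_prod, law, Measure.pi_pi,
    ← Finset.mul_prod_erase Finset.univ (fun j => B.dist j (s j)) (Finset.mem_univ i),
    ← Finset.mul_prod_erase Finset.univ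
      (fun j => B.dist j (Function.update s i Set.univ j)) (Finset.mem_univ i)]
  simp only [Function.update_self, measure_univ, one_mul]
  congr 1
  refine Finset.prod_congr rfl fun j hj => ?_
  rw [Function.update_of_ne (Finset.ne_of_mem_erase hj)]

theorem integral_law_eq_integral_update {f : (Fin n → ℝ) → ℝ} (i : Fin n)
    (hf : Measurable f) (hint : Integrable f B.law) :
    ∫ ω, f ω ∂B.law = ∫ v, ∫ ω, f (Function.update ω i v) ∂B.law ∂B.dist i := by
  have hmp := B.measurePreserving_update i
  calc ∫ ω, f ω ∂B.law
      = ∫ q : ℝ × (Fin n → ℝ), f (Function.update q.2 i q.1) ∂(B.dist i).prod B.law := by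
        rw [← integral_map (φ := fun q : ℝ × (Fin n → ℝ) => Function.update q.2 i q.1)
          hmp.measurable.aemeasurable hf.aestronglyMeasurable, hmp.map_eq]
    _ = _ := integral_prod _ (hmp.integrable_comp_of_integrable hint)

theorem integrable_integral_update {f : (Fin n → ℝ) → ℝ} (i : Fin n)
    (hint : Integrable f B.law) :
    Integrable (fun v => ∫ ω, f (Function.update ω i v) ∂B.law) (B.dist i) :=
  ((B.measurePreserving_update i).integrable_comp_of_integrable hint).integral_prod_left

variable {B}

/-- The boxes that are unopened after the history `h`. -/
noncomputable def unopened (h : List (Fin n × ℝ)) : Finset (Fin n) :=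
  Finset.univ.filter fun i => i ∉ h.map Prod.fst

theorem mem_unopened {h : List (Fin n × ℝ)} {i : Fin n} :
    i ∈ unopened h ↔ i ∉ h.map Prod.fst := by
  simp [unopened]

theorem unopened_cons (h : List (Fin n × ℝ)) (i : Fin n) (v : ℝ) :
    unopened ((i, v) :: h) = (unopened h).erase i := by
  ext j
  simp [mem_unopened]

theorem unopened_nil : unopened ([] : List (Fin n × ℝ)) = Finset.univ := by
  ext j
  simp [mem_unopened]

theorem unopened_congr {h h' : List (Fin n × ℝ)} (e : h.map Prod.fst = h'.map Prod.fst) :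
    unopened h = unopened h' := by
  ext j
  simp only [mem_unopened, e]

theorem _root_.BoxPolicy.act_mem_legalActions (π : BoxPolicy n) (h : List (Fin n × ℝ)) :
    π.act h ∈ legalActions (unopened h) := by
  cases e : π.act h with
  | quit => exact quit_mem_legalActions _
  | take i =>
    rw [take_mem_legalActions, mem_unopened]
    exact fun hi => (π.legal h i hi).2 e
  | probe i =>
    rw [probe_mem_legalActions, mem_unopened]
    exact fun hi => (π.legal h i hi).1 e

namespace BoxGame

variable (G : BoxGame B)

/-- The sum of the marginal payoffs that `π` collects on the values `ω` in at most `k` actions,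
from the state `I` and the history `h` on. -/
noncomputable def payoff (π : BoxPolicy n) (ω : Fin n → ℝ) :
    ℕ → ℝ → List (Fin n × ℝ) → ℝ
  | 0, _, _ => 0
  | k + 1, I, h =>
    match π.act h with
    | BoxAction.quit => 0
    | BoxAction.take i => G.prize i (ω i) - I
    | BoxAction.probe i =>
      max I (ω i) - I - B.cost i +
        payoff π ω k (G.next (max I (ω i))) ((i, G.obs I (ω i)) :: h)

variable {G} {π : BoxPolicy n} {ω : Fin n → ℝ} {k : ℕ} {I : ℝ} {h : List (Fin n × ℝ)} {i : Fin n}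

theorem payoff_of_quit (e : π.act h = BoxAction.quit) : G.payoff π ω (k + 1) I h = 0 := by
  simp only [payoff, e]

theorem payoff_of_take (e : π.act h = BoxAction.take i) :
    G.payoff π ω (k + 1) I h = G.prize i (ω i) - I := by
  simp only [payoff, e]

theorem payoff_of_probe (e : π.act h = BoxAction.probe i) :
    G.payoff π ω (k + 1) I h = max I (ω i) - I - B.cost i +
      G.payoff π ω k (G.next (max I (ω i))) ((i, G.obs I (ω i)) :: h) := by
  simp only [payoff, e]

variable (G π)

/-- The payoff from a history on does not depend on the values in the boxes already opened. -/
theorem payoff_update (ω : Fin n → ℝ) (v : ℝ) (k : ℕ) (I : ℝ) (h : List (Fin n × ℝ)) (i : Fin n)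
    (hi : i ∈ h.map Prod.fst) :
    G.payoff π (Function.update ω i v) k I h = G.payoff π ω k I h := by
  induction k generalizing I h with
  | zero => rfl
  | succ k ih =>
    cases e : π.act h with
    | quit => rw [payoff_of_quit e, payoff_of_quit e]
    | take j =>
      have : j ≠ i := fun hj => (π.legal h i hi).2 (hj ▸ e)
      rw [payoff_of_take e, payoff_of_take e, Function.update_of_ne this]
    | probe j =>
      have : j ≠ i := fun hj => (π.legal h i hi).1 (hj ▸ e)
      rw [payoff_of_probe e, payoff_of_probe e, Function.update_of_ne this,
        ih _ _ (by simpa using Or.inr (by simpa using hi))]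

theorem measurable_payoff (k t : ℕ) :
    Measurable fun q : (ℝ × (Fin t → Fin n × ℝ)) × (Fin n → ℝ) =>
      G.payoff π q.2 k q.1.1 (List.ofFn q.1.2) := by
  induction k generalizing t with
  | zero => exact measurable_const
  | succ k ih =>
    let F : BoxAction n → (ℝ × (Fin t → Fin n × ℝ)) × (Fin n → ℝ) → ℝ := fun a q =>
      match a with
      | BoxAction.quit => 0
      | BoxAction.take i => G.prize i (q.2 i) - q.1.1
      | BoxAction.probe i =>
        max q.1.1 (q.2 i) - q.1.1 - B.cost i +
          G.payoff π q.2 k (G.next (max q.1.1 (q.2 i)))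
            (List.ofFn (Fin.cons (i, G.obs q.1.1 (q.2 i)) q.1.2 : Fin (t + 1) → Fin n × ℝ))
    have hF : ∀ a, Measurable (F a) := by
      intro a
      cases a with
      | quit => exact measurable_const
      | take i =>
        have := G.measurable_prize i
        simp only [F]
        fun_prop
      | probe i =>
        have h1 := G.measurable_next
        have h2 : Measurable fun q : (ℝ × (Fin t → Fin n × ℝ)) × (Fin n → ℝ) =>
            G.obs q.1.1 (q.2 i) :=
          G.measurable_obs.comp (g := Function.uncurry G.obs) (f := fun
            q : (ℝ × (Fin t → Fin n × ℝ)) × (Fin n → ℝ) => (q.1.1, q.2 i)) (by fun_prop)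
        have h3 : Measurable fun q : (ℝ × (Fin t → Fin n × ℝ)) × (Fin n → ℝ) =>
            (Fin.cons (i, G.obs q.1.1 (q.2 i)) q.1.2 : Fin (t + 1) → Fin n × ℝ) := by
          refine measurable_pi_lambda _ fun j => ?_
          refine Fin.cases ?_ (fun j => ?_) j
          · simpa using measurable_const.prodMk h2
          · simp only [Fin.cons_succ]
            fun_prop
        refine Measurable.add (by fun_prop) ?_
        exact (ih (t + 1)).comp (((h1.comp (by fun_prop)).prodMk h3).prodMk measurable_snd)
    have ha : Measurable fun q : (ℝ × (Fin t → Fin n × ℝ)) × (Fin n → ℝ) =>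
        π.act (List.ofFn q.1.2) :=
      (π.measurable_act t).comp (measurable_snd.comp measurable_fst)
    convert Measurable.of_countable_choice hF ha using 2 with q
    simp only [payoff, F]
    cases π.act (List.ofFn q.1.2) <;> simp

theorem measurable_payoff_right (k : ℕ) (I : ℝ) (h : List (Fin n × ℝ)) :
    Measurable fun ω => G.payoff π ω k I h := by
  have := (G.measurable_payoff π k h.length).comp
    (measurable_prodMk_left (x := (I, fun j => h.get j)))
  simpa [Function.comp_def] using this

theorem ae_mem_Icc : ∀ᵐ ω ∂B.law, ∀ i,
    ω i ∈ Set.Icc 0 B.maxV ∧ G.prize i (ω i) ∈ Set.Icc 0 B.maxV := by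
  rw [ae_all_iff]
  intro i
  exact (measurePreserving_eval B.dist i).quasiMeasurePreserving.ae
    ((B.ae_mem_Icc i).and (G.prize_mem i))

theorem abs_payoff_le {ω : Fin n → ℝ}
    (hω : ∀ i, ω i ∈ Set.Icc 0 B.maxV ∧ G.prize i (ω i) ∈ Set.Icc 0 B.maxV) (k : ℕ) {I : ℝ}
    (hI : I ∈ Set.Icc 0 B.maxV) (h : List (Fin n × ℝ)) :
    |G.payoff π ω k I h| ≤ k * B.gainBound := by
  induction k generalizing I h with
  | zero => simp [payoff]
  | succ k ih =>
    have hb := B.gainBound_nonneg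
    have hk : 0 ≤ (k : ℝ) * B.gainBound := by positivity
    push_cast
    cases e : π.act h with
    | quit => rw [payoff_of_quit e, abs_zero]; positivity
    | take i =>
      rw [payoff_of_take e]
      linarith [B.abs_sub_le_gainBound (hω i).2 hI]
    | probe i =>
      rw [payoff_of_probe e]
      have h1 := B.abs_probe_le_gainBound hI (hω i).1 i
      have h2 := ih (G.next_mem _ (B.max_mem_Icc hI (hω i).1)) ((i, G.obs I (ω i)) :: h)
      exact (abs_add_le _ _).trans (by linarith)

theorem integrable_payoff (k : ℕ) {I : ℝ} (hI : I ∈ Set.Icc 0 B.maxV) (h : List (Fin n × ℝ)) :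
    Integrable (fun ω => G.payoff π ω k I h) B.law := by
  refine Integrable.of_bound (G.measurable_payoff_right π k I h).aestronglyMeasurable
    (k * B.gainBound) ?_
  filter_upwards [G.ae_mem_Icc] with ω hω using G.abs_payoff_le π hω k hI h

/-- Only the mean of the prize matters, so the raw game (prize `v`) and the discrete game (prize
`mean i`) obey the same form of recursion. -/
theorem integral_prize_law (i : Fin n) (I : ℝ) :
    ∫ ω, (G.prize i (ω i) - I) ∂B.law = B.mean i - I := by
  have hint : Integrable (G.prize i) (B.dist i) := by
    refine Integrable.of_bound (G.measurable_prize i).aestronglyMeasurable B.maxV ?_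
    filter_upwards [G.prize_mem i] with v hv
    rw [Real.norm_eq_abs, abs_of_nonneg hv.1]
    exact hv.2
  have h1 : ∫ ω : Fin n → ℝ, (G.prize i (ω i) - I) ∂B.law =
      ∫ v, (G.prize i v - I) ∂B.dist i :=
    integral_comp_eval (μ := B.dist) (i := i) (f := fun v => G.prize i v - I)
      ((G.measurable_prize i).sub_const I).aestronglyMeasurable
  rw [h1, integral_sub hint (integrable_const I), G.integral_prize]
  simp

variable {π}

/-- One Bellman step: redraw the value of box `i` independently. Once `i` is in the history,
`payoff_update` removes the redrawn coordinate from the continuation. -/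
theorem integrable_probe_payoff (k : ℕ) {I : ℝ} (hI : I ∈ Set.Icc 0 B.maxV)
    {h : List (Fin n × ℝ)} {i : Fin n} (e : π.act h = BoxAction.probe i) :
    Integrable (fun v => max I v - I - B.cost i +
        ∫ ω, G.payoff π ω k (G.next (max I v)) ((i, G.obs I v) :: h) ∂B.law) (B.dist i) ∧
      ∫ ω, G.payoff π ω (k + 1) I h ∂B.law = ∫ v, (max I v - I - B.cost i +
        ∫ ω, G.payoff π ω k (G.next (max I v)) ((i, G.obs I v) :: h) ∂B.law) ∂B.dist i := by
  have hint := G.integrable_payoff π (k + 1) hI h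
  have key : ∀ᵐ v ∂B.dist i,
      ∫ ω, G.payoff π (Function.update ω i v) (k + 1) I h ∂B.law =
        max I v - I - B.cost i +
          ∫ ω, G.payoff π ω k (G.next (max I v)) ((i, G.obs I v) :: h) ∂B.law := by
    filter_upwards [B.ae_mem_Icc i] with v hv
    have : ∀ ω, G.payoff π (Function.update ω i v) (k + 1) I h =
        max I v - I - B.cost i +
          G.payoff π ω k (G.next (max I v)) ((i, G.obs I v) :: h) := fun ω => by
      rw [payoff_of_probe e, Function.update_self, G.payoff_update π _ _ _ _ _ _ (by simp)]
    simp_rw [this]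
    rw [integral_add (integrable_const _)
      (G.integrable_payoff π k (G.next_mem _ (B.max_mem_Icc hI hv)) _)]
    simp
  constructor
  · exact (B.integrable_integral_update i hint).congr key
  · rw [B.integral_law_eq_integral_update i (G.measurable_payoff_right π (k + 1) I h) hint]
    exact integral_congr_ae key

/-- No policy collects more than the value function. -/
theorem integral_payoff_le_value (k : ℕ) {I : ℝ} (hI : I ∈ Set.Icc 0 B.maxV)
    (h : List (Fin n × ℝ)) :
    ∫ ω, G.payoff π ω k I h ∂B.law ≤ B.value G.next k (unopened h) I := by
  induction k generalizing I h with
  | zero => simp [payoff, value]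
  | succ k ih =>
    refine le_trans ?_ (B.actionValue_le_value G.next k _ I (π.act_mem_legalActions h))
    cases e : π.act h with
    | quit => simp [payoff_of_quit e, actionValue]
    | take i =>
      simp_rw [payoff_of_take e]
      exact (G.integral_prize_law i I).le
    | probe i =>
      obtain ⟨h1, h2⟩ := G.integrable_probe_payoff k hI e
      rw [h2]
      refine integral_mono_ae h1
        (B.integrable_probe G.measurable_next G.next_mem k _ hI i) ?_
      filter_upwards [B.ae_mem_Icc i] with v hv
      have := ih (G.next_mem _ (B.max_mem_Icc hI hv)) ((i, G.obs I v) :: h)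
      rw [unopened_cons] at this
      exact add_le_add le_rfl this

/-- A policy that always picks an action of maximal value collects the value function. -/
theorem integral_payoff_eq_value
    (hπ : ∀ k h, h.length + (k + 1) = n →
      B.actionValue G.next (B.value G.next k) (unopened h) (G.stateOf h) (π.act h) =
        B.value G.next (k + 1) (unopened h) (G.stateOf h))
    (k : ℕ) (h : List (Fin n × ℝ)) (hk : h.length + k = n)
    (hI : G.stateOf h ∈ Set.Icc 0 B.maxV) :
    ∫ ω, G.payoff π ω k (G.stateOf h) h ∂B.law =
      B.value G.next k (unopened h) (G.stateOf h) := by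
  induction k generalizing h with
  | zero => simp [payoff, value]
  | succ k ih =>
    rw [← hπ k h hk]
    cases e : π.act h with
    | quit => simp [payoff_of_quit e, actionValue]
    | take i =>
      simp_rw [payoff_of_take e]
      exact G.integral_prize_law i _
    | probe i =>
      rw [(G.integrable_probe_payoff k hI e).2]
      refine integral_congr_ae ?_
      filter_upwards [B.ae_mem_Icc i] with v hv
      have hc := G.stateOf_cons h i v
      have := ih ((i, G.obs (G.stateOf h) v) :: h) (by simp; omega)
        (hc ▸ G.next_mem _ (B.max_mem_Icc hI hv))
      rw [hc, unopened_cons] at this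
      rw [this]

end BoxGame

end PNOI

/-! ### Measurable optimal policies; OPT and OPT^L as values of the recursion. -/

namespace PNOI

variable {n : ℕ} {B : PNOI n}

namespace BoxGame

variable (G : BoxGame B)

/-- The horizon `n - h.length - 1` truncates to 0 on histories of length at least `n`; there only
legality is needed later. -/
theorem exists_optimal_action (f : ℕ → BoxAction n) (hf : Function.Surjective f)
    (h : List (Fin n × ℝ)) :
    ∃ N, f N ∈ legalActions (unopened h) ∧
      B.actionValue G.next (B.value G.next (n - h.length - 1)) (unopened h) (G.stateOf h) (f N) =
        B.value G.next (n - h.length - 1 + 1) (unopened h) (G.stateOf h) := by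
  obtain ⟨a, ha, e⟩ := B.exists_value_eq G.next (n - h.length - 1) (unopened h) (G.stateOf h)
  obtain ⟨N, rfl⟩ := hf a
  exact ⟨N, ha, e⟩

/-- Erasing the observed numbers makes the unopened set a function of a finite type of box
sequences, so measurability can be checked sequence by sequence. -/
theorem unopened_ofFn {t : ℕ} (h : Fin t → Fin n × ℝ) :
    unopened (List.ofFn h) =
      unopened (List.ofFn fun j => (((fun j => (h j).1) : Fin t → Fin n) j, (0 : ℝ))) :=
  unopened_congr (by simp [List.map_ofFn, Function.comp_def])

theorem measurableSet_optimal_action (a : BoxAction n) (t k : ℕ) :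
    MeasurableSet {h : Fin t → Fin n × ℝ | a ∈ legalActions (unopened (List.ofFn h)) ∧
      B.actionValue G.next (B.value G.next k) (unopened (List.ofFn h))
          (G.stateOf (List.ofFn h)) a =
        B.value G.next (k + 1) (unopened (List.ofFn h)) (G.stateOf (List.ofFn h))} := by
  have hfst : Measurable fun (h : Fin t → Fin n × ℝ) (j : Fin t) => (h j).1 := by fun_prop
  let U : (Fin t → Fin n) → Finset (Fin n) := fun c => unopened (List.ofFn fun j => (c j, (0 : ℝ)))
  have hU : ∀ h : Fin t → Fin n × ℝ, unopened (List.ofFn h) = U fun j => (h j).1 :=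
    unopened_ofFn
  simp_rw [hU]
  refine MeasurableSet.inter ?_ (measurableSet_eq_fun ?_ ?_)
  · exact hfst (MeasurableSet.of_discrete (s := {c | a ∈ legalActions (U c)}))
  · exact Measurable.of_countable_choice (f := fun c h => B.actionValue G.next
      (B.value G.next k) (U c) (G.stateOf (List.ofFn h)) a)
      (fun c => (B.measurable_actionValue G.measurable_next
        (fun S => B.measurable_value G.measurable_next k S) (U c) a).comp
          (G.measurable_stateOf t)) hfst
  · exact Measurable.of_countable_choice (f := fun c h =>
      B.value G.next (k + 1) (U c) (G.stateOf (List.ofFn h)))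
      (fun c => (B.measurable_value G.measurable_next (k + 1) (U c)).comp
          (G.measurable_stateOf t)) hfst

theorem exists_optimal_policy : ∃ π : BoxPolicy n, ∀ k h, h.length + (k + 1) = n →
      B.actionValue G.next (B.value G.next k) (unopened h) (G.stateOf h) (π.act h) =
        B.value G.next (k + 1) (unopened h) (G.stateOf h) := by
  classical
  have : Nonempty (BoxAction n) := ⟨BoxAction.quit⟩
  -- Taking the first optimal action in a fixed enumeration makes the selection measurable.
  obtain ⟨f, hf⟩ := exists_surjective_nat (BoxAction n)
  have hex := G.exists_optimal_action f hf
  refine ⟨⟨fun h => f (Nat.find (hex h)), fun t => ?_, fun h i hi => ?_⟩, fun k h hk => ?_⟩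
  · refine (measurable_from_nat (f := f)).comp
      (measurable_find (fun h : Fin t → Fin n × ℝ => hex (List.ofFn h)) fun N => ?_)
    simp only [List.length_ofFn]
    exact G.measurableSet_optimal_action (f N) t (n - t - 1)
  · have hl := (Nat.find_spec (hex h)).1
    constructor
    · intro e
      rw [e, probe_mem_legalActions, mem_unopened] at hl
      exact hl hi
    · intro e
      rw [e, take_mem_legalActions, mem_unopened] at hl
      exact hl hi
  · have hs := (Nat.find_spec (hex h)).2
    have hk' : n - h.length - 1 = k := by omega
    simp only [hk'] at hs ⊢
    exact hs

/-- The value function is the optimal expected payoff. -/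
theorem isGreatest_value :
    IsGreatest (Set.range fun π : BoxPolicy n => ∫ ω, G.payoff π ω n 0 [] ∂B.law)
      (B.value G.next n Finset.univ 0) := by
  have h0 : (0 : ℝ) ∈ Set.Icc 0 B.maxV := ⟨le_rfl, B.maxV_nonneg⟩
  constructor
  · obtain ⟨π, hπ⟩ := G.exists_optimal_policy
    refine ⟨π, ?_⟩
    have := G.integral_payoff_eq_value hπ n [] (by simp) (by rw [G.stateOf_nil]; exact h0)
    rwa [unopened_nil, G.stateOf_nil] at this
  · rintro _ ⟨π, rfl⟩
    have := G.integral_payoff_le_value (π := π) n h0 []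
    rwa [unopened_nil] at this

end BoxGame

theorem bestSeen_cons (q : Fin n × ℝ) (h : List (Fin n × ℝ)) :
    bestSeen (q :: h) = max q.2 (bestSeen h) := rfl

theorem spent_cons (q : Fin n × ℝ) (h : List (Fin n × ℝ)) :
    B.spent (q :: h) = B.cost q.1 + B.spent h := by
  simp [spent]

theorem measurable_bestSeen (t : ℕ) :
    Measurable fun h : Fin t → Fin n × ℝ => bestSeen (List.ofFn h) := by
  induction t with
  | zero => simp [bestSeen]
  | succ t ih =>
    simp only [List.ofFn_succ, bestSeen_cons]
    have : Measurable fun (h : Fin (t + 1) → Fin n × ℝ) (j : Fin t) => h j.succ := by fun_prop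
    exact Measurable.max (by fun_prop) (ih.comp this)

variable (B)

/-- The original problem, in terms of marginal payoffs. -/
noncomputable def rawGame : BoxGame B where
  next x := x
  obs _ v := v
  prize _ v := v
  stateOf := bestSeen
  measurable_next := measurable_id
  measurable_obs := measurable_snd
  measurable_prize _ := measurable_id
  measurable_stateOf := measurable_bestSeen
  next_mem _ hx := hx
  prize_mem := B.ae_mem_Icc
  integral_prize _ := rfl
  stateOf_nil := rfl
  stateOf_cons h _ v := max_comm v (bestSeen h)

/-- The most recent observation in a history, `0` if there is none. -/
noncomputable def lastSeen : List (Fin n × ℝ) → ℝ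
  | [] => 0
  | q :: _ => q.2

theorem measurable_lastSeen (t : ℕ) :
    Measurable fun h : Fin t → Fin n × ℝ => lastSeen (List.ofFn h) := by
  cases t with
  | zero => simp [lastSeen]
  | succ t =>
    simp only [List.ofFn_succ, lastSeen]
    fun_prop

/-- The L-PNOI instance with discretization function `D`. -/
noncomputable def discreteGame (D : ℝ → ℝ) (hD : Measurable D)
    (hmem : ∀ x ∈ Set.Icc 0 B.maxV, D x ∈ Set.Icc 0 B.maxV) : BoxGame B where
  next := D
  obs x v := D (max x v)
  prize i _ := B.mean i
  stateOf := lastSeen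
  measurable_next := hD
  measurable_obs := hD.comp (measurable_fst.max measurable_snd)
  measurable_prize _ := measurable_const
  measurable_stateOf := measurable_lastSeen
  next_mem := hmem
  prize_mem i := Filter.Eventually.of_forall fun _ => B.mean_mem_Icc i
  integral_prize i := by simp
  stateOf_nil := rfl
  stateOf_cons _ _ _ := rfl

/-- Marginal payoffs telescope: those collected along `h` add up to `bestSeen h - spent h`. -/
theorem payoffFrom_eq (π : BoxPolicy n) (ω : Fin n → ℝ) (k : ℕ) (h : List (Fin n × ℝ)) :
    B.payoffFrom π ω k h =
      bestSeen h - B.spent h + B.rawGame.payoff π ω k (bestSeen h) h := by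
  induction k generalizing h with
  | zero => simp [payoffFrom, BoxGame.payoff]
  | succ k ih =>
    cases e : π.act h with
    | quit => simp [payoffFrom, e, BoxGame.payoff_of_quit e]
    | take i =>
      rw [BoxGame.payoff_of_take e]
      simp only [payoffFrom, e, rawGame]
      ring
    | probe i =>
      rw [BoxGame.payoff_of_probe e]
      simp only [payoffFrom, e, ih, bestSeen_cons, spent_cons, rawGame, max_comm (ω i)]
      ring

theorem payoffFromL_eq {D : ℝ → ℝ} (hD : Measurable D)
    (hmem : ∀ x ∈ Set.Icc 0 B.maxV, D x ∈ Set.Icc 0 B.maxV) (π : BoxPolicy n) (ω : Fin n → ℝ)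
    (k : ℕ) (I : ℝ) (h : List (Fin n × ℝ)) :
    B.payoffFromL D π ω k I h = (B.discreteGame D hD hmem).payoff π ω k I h := by
  induction k generalizing I h with
  | zero => rfl
  | succ k ih =>
    cases e : π.act h with
    | quit => simp [payoffFromL, gainL, e, BoxGame.payoff_of_quit e]
    | take i =>
      rw [BoxGame.payoff_of_take e]
      simp [payoffFromL, gainL, e, discreteGame]
    | probe i =>
      rw [BoxGame.payoff_of_probe e]
      simp only [payoffFromL, gainL, stepL, e, ih]
      rfl

theorem opt_eq_value : B.opt = B.value (fun x => x) n Finset.univ 0 := by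
  have : B.expPayoff = fun π => ∫ ω, B.rawGame.payoff π ω n 0 [] ∂B.law := by
    ext π
    refine integral_congr_ae (Filter.Eventually.of_forall fun ω => ?_)
    have := B.payoffFrom_eq π ω n []
    simpa [bestSeen, spent] using this
  rw [opt, this]
  exact B.rawGame.isGreatest_value.csSup_eq

theorem optL_eq_value {D : ℝ → ℝ} (hD : Measurable D)
    (hmem : ∀ x ∈ Set.Icc 0 B.maxV, D x ∈ Set.Icc 0 B.maxV) :
    B.optL D = B.value D n Finset.univ 0 := by
  have : B.expPayoffL D = fun π => ∫ ω, (B.discreteGame D hD hmem).payoff π ω n 0 [] ∂B.law := by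
    ext π
    simp only [expPayoffL, B.payoffFromL_eq hD hmem]
  rw [optL, this]
  exact (B.discreteGame D hD hmem).isGreatest_value.csSup_eq

end PNOI

/-! ### The rounding map. -/

namespace PNOI

section RoundUp

variable {m : ℕ} {p : ℕ → ℝ}

theorem points_le (hp : ∀ j, 1 ≤ j → j < m → p j < p (j + 1)) {i j : ℕ} (hi : 1 ≤ i)
    (hij : i ≤ j) (hj : j ≤ m) : p i ≤ p j := by
  induction j, hij using Nat.le_induction with
  | base => exact le_rfl
  | succ j hij ih => exact (ih (by omega)).trans (hp j (by omega) (by omega)).le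

theorem points_lt (hp : ∀ j, 1 ≤ j → j < m → p j < p (j + 1)) {i j : ℕ} (hi : 1 ≤ i)
    (hij : i < j) (hj : j ≤ m) : p i < p j :=
  (hp i hi (by omega)).trans_le (points_le hp (by omega) hij hj)

theorem roundUp_eq_self {x : ℝ} (h : ¬(p 1 ≤ x ∧ x ≤ p m)) : roundUp m p x = x := by
  rw [roundUp, if_neg h]

theorem exists_roundUp_eq (hm : 1 ≤ m) (hp : ∀ j, 1 ≤ j → j < m → p j < p (j + 1)) {x : ℝ}
    (h1 : p 1 ≤ x) (h2 : x ≤ p m) :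
    ∃ j, 1 ≤ j ∧ j ≤ m ∧ roundUp m p x = p j ∧ x ≤ p j ∧ ∀ i, 1 ≤ i → i < j → p i < x := by
  classical
  have hex : ∃ j, 1 ≤ j ∧ j ≤ m ∧ x ≤ p j := ⟨m, hm, le_rfl, h2⟩
  obtain ⟨hj1, hj2, hj3⟩ := Nat.find_spec hex
  have hmin : ∀ i, 1 ≤ i → i < Nat.find hex → p i < x := fun i hi hij => by
    have := Nat.find_min hex hij
    by_contra hc
    exact this ⟨hi, by omega, not_lt.1 hc⟩
  refine ⟨Nat.find hex, hj1, hj2, ?_, hj3, hmin⟩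
  rw [roundUp, if_pos ⟨h1, h2⟩]
  refine IsLeast.csInf_eq ⟨⟨_, hj1, hj2, rfl, hj3⟩, ?_⟩
  rintro t ⟨i, hi1, hi2, rfl, hi3⟩
  by_contra hc
  rcases lt_or_ge i (Nat.find hex) with hlt | hge
  · exact absurd (hmin i hi1 hlt) (not_lt.2 hi3)
  · exact hc (points_le hp hj1 hge hi2)

theorem le_roundUp (hm : 1 ≤ m) (hp : ∀ j, 1 ≤ j → j < m → p j < p (j + 1)) (x : ℝ) :
    x ≤ roundUp m p x := by
  by_cases h : p 1 ≤ x ∧ x ≤ p m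
  · obtain ⟨j, -, -, e, hx, -⟩ := exists_roundUp_eq hm hp h.1 h.2
    rwa [e]
  · rw [roundUp_eq_self h]

theorem roundUp_le (hm : 1 ≤ m) (hp : ∀ j, 1 ≤ j → j < m → p j < p (j + 1)) {x : ℝ}
    (hx : x ≤ p m) : roundUp m p x ≤ p m := by
  by_cases h : p 1 ≤ x ∧ x ≤ p m
  · obtain ⟨j, h1, h2, e, -, -⟩ := exists_roundUp_eq hm hp h.1 h.2
    rw [e]
    exact points_le hp h1 h2 le_rfl
  · rwa [roundUp_eq_self h]

/-- Supplies the fixed state that `lowProb_mul_surplus_le_value` needs. -/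
theorem roundUp_point (hm : 1 ≤ m) (hp : ∀ j, 1 ≤ j → j < m → p j < p (j + 1)) {j : ℕ}
    (h1 : 1 ≤ j) (h2 : j ≤ m) : roundUp m p (p j) = p j := by
  obtain ⟨i, hi1, hi2, e, hle, hmin⟩ := exists_roundUp_eq hm hp
    (points_le hp le_rfl h1 h2) (points_le hp h1 h2 le_rfl)
  rw [e]
  rcases lt_trichotomy i j with h | h | h
  · exact absurd (points_lt hp hi1 h h2) (not_lt.2 hle)
  · rw [h]
  · exact absurd (hmin j h1 h) (lt_irrefl _)

theorem monotone_roundUp (hm : 1 ≤ m) (hp : ∀ j, 1 ≤ j → j < m → p j < p (j + 1)) :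
    Monotone (roundUp m p) := by
  intro x y hxy
  by_cases hx : p 1 ≤ x ∧ x ≤ p m
  · by_cases hy : y ≤ p m
    · obtain ⟨i, hi1, hi2, e, -, hmin⟩ := exists_roundUp_eq hm hp hx.1 hx.2
      obtain ⟨j, hj1, hj2, e', hle, -⟩ := exists_roundUp_eq hm hp (hx.1.trans hxy) hy
      rw [e, e']
      refine points_le hp hi1 ?_ hj2
      by_contra hc
      exact absurd (hmin j hj1 (not_le.1 hc)) (not_lt.2 (hxy.trans hle))
    · refine (roundUp_le hm hp hx.2).trans ?_
      rw [roundUp_eq_self fun h => hy h.2]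
      exact (not_le.1 hy).le
  · rw [roundUp_eq_self hx]
    exact hxy.trans (le_roundUp hm hp y)

end RoundUp

/-! ### Surplus bounds and the loss from rounding. -/

variable {n : ℕ} (B : PNOI n)

theorem integrable_max_sub (t : ℝ) (i : Fin n) :
    Integrable (fun v => max (v - t) 0) (B.dist i) :=
  ((B.integrable_value i).sub (integrable_const t)).pos_part

theorem integrable_max_min_sub (t x : ℝ) (i : Fin n) :
    Integrable (fun v => max (min v t - x) 0) (B.dist i) :=
  (((B.integrable_value i).inf (integrable_const t)).sub (integrable_const x)).pos_part

variable (τ : Fin n → ℝ)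

theorem surplus_nonneg (S : Finset (Fin n)) (x : ℝ) : 0 ≤ B.surplus τ S x :=
  Finset.sum_nonneg fun _ _ => integral_nonneg fun _ => le_max_right _ _

theorem surplus_eq_add_erase {S : Finset (Fin n)} {i : Fin n} (hi : i ∈ S) (x : ℝ) :
    B.surplus τ S x =
      ∫ v, max (min v (τ i) - x) 0 ∂B.dist i + B.surplus τ (S.erase i) x :=
  (Finset.add_sum_erase S (fun i => ∫ v, max (min v (τ i) - x) 0 ∂B.dist i) hi).symm

theorem surplus_mono {S T : Finset (Fin n)} (h : S ⊆ T) (x : ℝ) :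
    B.surplus τ S x ≤ B.surplus τ T x :=
  Finset.sum_le_sum_of_subset_of_nonneg h fun _ _ _ => integral_nonneg fun _ => le_max_right _ _

theorem integral_max_min_sub_antitone (t : ℝ) (i : Fin n) :
    Antitone fun x => ∫ v, max (min v t - x) 0 ∂B.dist i := fun x y hxy =>
  integral_mono (B.integrable_max_min_sub t y i) (B.integrable_max_min_sub t x i)
    fun v => max_le_max (by linarith) le_rfl

theorem surplus_antitone (S : Finset (Fin n)) : Antitone (B.surplus τ S) := fun _ _ hxy =>
  Finset.sum_le_sum fun i _ => B.integral_max_min_sub_antitone (τ i) i hxy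

/-- Every summand drops by a non-negative amount. This carries the discretization hypothesis from
all boxes to the unopened ones. -/
theorem surplus_drop_mono {S T : Finset (Fin n)} (h : S ⊆ T) {x y : ℝ} (hxy : x ≤ y) :
    B.surplus τ S x - B.surplus τ S y ≤ B.surplus τ T x - B.surplus τ T y := by
  unfold surplus
  rw [← Finset.sum_sub_distrib, ← Finset.sum_sub_distrib]
  exact Finset.sum_le_sum_of_subset_of_nonneg h fun i _ _ =>
    sub_nonneg.2 (B.integral_max_min_sub_antitone (τ i) i hxy)

/-- The probability that no `κᵢ = min vᵢ τᵢ` with `i ∈ S` exceeds `x`. -/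
noncomputable def lowProb (S : Finset (Fin n)) (x : ℝ) : ℝ :=
  ∏ i ∈ S, (B.dist i).real {v | min v (τ i) ≤ x}

theorem lowProb_nonneg (S : Finset (Fin n)) (x : ℝ) : 0 ≤ B.lowProb τ S x :=
  Finset.prod_nonneg fun _ _ => measureReal_nonneg

theorem lowProb_le_one (S : Finset (Fin n)) (x : ℝ) : B.lowProb τ S x ≤ 1 :=
  Finset.prod_le_one (fun _ _ => measureReal_nonneg) fun _ _ => measureReal_le_one

theorem lowProb_mono (S : Finset (Fin n)) : Monotone (B.lowProb τ S) := fun _ _ hxy =>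
  Finset.prod_le_prod (fun _ _ => measureReal_nonneg) fun _ _ =>
    measureReal_mono fun _ (hv : _ ≤ _) => hv.trans hxy

theorem lowProb_eq_mul_erase {S : Finset (Fin n)} {i : Fin n} (hi : i ∈ S) (x : ℝ) :
    B.lowProb τ S x =
      (B.dist i).real {v | min v (τ i) ≤ x} * B.lowProb τ (S.erase i) x :=
  (Finset.mul_prod_erase S (fun i => (B.dist i).real {v | min v (τ i) ≤ x}) hi).symm

theorem lowProb_anti {S T : Finset (Fin n)} (h : S ⊆ T) (x : ℝ) :
    B.lowProb τ T x ≤ B.lowProb τ S x :=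
  (Finset.prod_sdiff h).symm.trans_le (mul_le_of_le_one_left (B.lowProb_nonneg τ S x)
    (B.lowProb_le_one τ (T \ S) x))

variable {τ}

theorem surplus_eq_zero {S : Finset (Fin n)} {x : ℝ} (h : ∀ i ∈ S, τ i ≤ x) :
    B.surplus τ S x = 0 := by
  refine Finset.sum_eq_zero fun i hi => ?_
  have : ∀ v : ℝ, max (min v (τ i) - x) 0 = 0 := fun v =>
    max_eq_right (sub_nonpos.2 ((min_le_right _ _).trans (h i hi)))
  simp [this]

theorem lowProb_eq_one {S : Finset (Fin n)} {x : ℝ} (h : ∀ i ∈ S, τ i ≤ x) :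
    B.lowProb τ S x = 1 := by
  refine Finset.prod_eq_one fun i hi => ?_
  have : {v : ℝ | min v (τ i) ≤ x} = Set.univ :=
    Set.eq_univ_of_forall fun v => (min_le_right _ _).trans (h i hi)
  rw [this, probReal_univ]

/-- With `t = τ i` the last term has expectation `cost i`, so in expectation the cost cancels and
only the surplus of `κᵢ` remains. -/
theorem max_sub_le (x v t : ℝ) : max x v - x ≤ max (min v t - x) 0 + max (v - t) 0 := by
  rcases le_total v t with h | h <;> rcases le_total x v with h' | h' <;>
  rcases le_total x t with h'' | h'' <;>
  simp [h, h', h''] <;> grind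

theorem max_sub_eq {x t : ℝ} (hxt : x < t) (v : ℝ) :
    max x v - x = max (min v t - x) 0 + max (v - t) 0 := by
  grind

/-- In a large state the surplus bounds what can still be gained. -/
theorem value_le_surplus (hτ : ∀ i, B.IsIndex i (τ i)) (k : ℕ) (S : Finset (Fin n)) {x : ℝ}
    (hx : x ∈ Set.Icc 0 B.maxV) (hmean : ∀ i, B.mean i ≤ x) :
    B.value (fun x => x) k S x ≤ B.surplus τ S x := by
  induction k generalizing S x with
  | zero => exact B.surplus_nonneg τ S x
  | succ k ih =>
    refine B.value_succ_le (B.surplus_nonneg τ S x) (fun i _ => ?_) fun i hi => ?_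
    · exact (sub_nonpos.2 (hmean i)).trans (B.surplus_nonneg τ S x)
    · have h1 := B.integrable_max_min_sub (τ i) x i
      have h2 := B.integrable_max_sub (τ i) i
      have h12 : Integrable (fun v => max (min v (τ i) - x) 0 + max (v - τ i) 0) (B.dist i) :=
        h1.add h2
      have hle : ∫ v, (max x v - x - B.cost i + B.value (fun x => x) k (S.erase i) (max x v))
            ∂B.dist i ≤
          ∫ v, (max (min v (τ i) - x) 0 + max (v - τ i) 0 +
            (B.surplus τ (S.erase i) x - B.cost i)) ∂B.dist i := by
        refine integral_mono_ae (B.integrable_probe (D := fun x => x) measurable_id (fun _ h => h) k _ hx i)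
          (h12.add (integrable_const _)) ?_
        filter_upwards [B.ae_mem_Icc i] with v hv
        have h3 := ih (S.erase i) (B.max_mem_Icc hx hv) fun j => (hmean j).trans (le_max_left x v)
        have h4 := B.surplus_antitone τ (S.erase i) (le_max_left x v)
        have h5 := max_sub_le x v (τ i)
        linarith
      refine hle.trans (le_of_eq ?_)
      rw [integral_add h12 (integrable_const _), integral_add h1 h2, hτ i,
        B.surplus_eq_add_erase τ hi x]
      simp

/-- The index equation cancels the cost. Here `b` is a gain received in any case and `R` the extra
continuation value when `κᵢ ≤ x`. -/
theorem integral_low_split (hτ : ∀ i, B.IsIndex i (τ i)) (i : Fin n) (x b R : ℝ) :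
    Integrable (fun v => max (min v (τ i) - x) 0 + max (v - τ i) 0 +
      (b - B.cost i + Set.indicator {v | min v (τ i) ≤ x} (fun _ => R) v)) (B.dist i) ∧
    ∫ v, (max (min v (τ i) - x) 0 + max (v - τ i) 0 +
      (b - B.cost i + Set.indicator {v | min v (τ i) ≤ x} (fun _ => R) v)) ∂B.dist i =
    ∫ v, max (min v (τ i) - x) 0 ∂B.dist i + b +
      (B.dist i).real {v | min v (τ i) ≤ x} * R := by
  have h1 := B.integrable_max_min_sub (τ i) x i
  have h2 := B.integrable_max_sub (τ i) i
  have h12 : Integrable (fun v => max (min v (τ i) - x) 0 + max (v - τ i) 0) (B.dist i) :=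
    h1.add h2
  have hs : MeasurableSet {v : ℝ | min v (τ i) ≤ x} :=
    measurableSet_le (by fun_prop) measurable_const
  have h3 : Integrable (Set.indicator {v : ℝ | min v (τ i) ≤ x} fun _ => R) (B.dist i) :=
    (integrable_const R).indicator hs
  have h4 : Integrable (fun v => b - B.cost i +
      Set.indicator {v | min v (τ i) ≤ x} (fun _ => R) v) (B.dist i) :=
    (integrable_const _).add h3
  refine ⟨h12.add h4, ?_⟩
  rw [integral_add h12 h4, integral_add h1 h2, integral_add (integrable_const _) h3,
    hτ i, integral_indicator_const R hs]
  simp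
  ring

/-- In a state that the transition keeps, opening boxes until the state changes is almost as good
as the surplus. -/
theorem lowProb_mul_surplus_le_value (hτ : ∀ i, B.IsIndex i (τ i)) {D : ℝ → ℝ}
    (hD : Measurable D) (hmem : ∀ x ∈ Set.Icc 0 B.maxV, D x ∈ Set.Icc 0 B.maxV) {I : ℝ}
    (hI : I ∈ Set.Icc 0 B.maxV) (hDI : D I = I) (k : ℕ) (S : Finset (Fin n)) (hk : S.card ≤ k) :
    B.lowProb τ S I * B.surplus τ S I ≤ B.value D k S I := by
  by_cases hS : ∀ i ∈ S, τ i ≤ I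
  · rw [B.surplus_eq_zero hS, mul_zero]
    exact B.value_nonneg' D k S I
  push Not at hS
  obtain ⟨i, hi, hIi⟩ := hS
  have hpos := Finset.card_pos.2 ⟨i, hi⟩
  obtain ⟨k, rfl⟩ : ∃ l, k = l + 1 := ⟨k - 1, by omega⟩
  have ih := lowProb_mul_surplus_le_value hτ hD hmem hI hDI k (S.erase i)
    (by rw [Finset.card_erase_of_mem hi]; omega)
  refine le_trans ?_ (B.actionValue_le_value D k S I (probe_mem_legalActions.2 hi))
  obtain ⟨h1, h2⟩ := B.integral_low_split hτ i I 0 (B.value D k (S.erase i) I)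
  have hle := integral_mono_ae h1 (B.integrable_probe hD hmem k (S.erase i) hI i)
    (Filter.Eventually.of_forall fun v => by
      have h3 := max_sub_eq hIi v
      have h4 := B.value_nonneg' D k (S.erase i) (D (max I v))
      beta_reduce
      by_cases hv : min v (τ i) ≤ I
      -- As `I < τ i`, a low `κᵢ` means a low `v`: the state stays at `I` and the search goes on.
      -- Otherwise the continuation is bounded below by 0.
      · have hvI : v ≤ I := (min_le_iff.1 hv).resolve_right (not_le.2 hIi)
        rw [Set.indicator_of_mem (by exact hv)]
        rw [max_eq_left hvI] at h3 ⊢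
        rw [hDI]
        linarith
      · rw [Set.indicator_of_notMem (by exact hv)]
        linarith)
  rw [h2] at hle
  refine le_trans ?_ hle
  rw [B.surplus_eq_add_erase τ hi, B.lowProb_eq_mul_erase τ hi]
  have hq : 0 ≤ (B.dist i).real {v | min v (τ i) ≤ I} := measureReal_nonneg
  have hQ : (B.dist i).real {v | min v (τ i) ≤ I} * B.lowProb τ (S.erase i) I ≤ 1 := by
    rw [← B.lowProb_eq_mul_erase τ hi]
    exact B.lowProb_le_one τ S I
  have hf : 0 ≤ ∫ v, max (min v (τ i) - I) 0 ∂B.dist i :=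
    integral_nonneg fun _ => le_max_right _ _
  nlinarith [mul_le_mul_of_nonneg_left ih hq, mul_le_mul_of_nonneg_right hQ hf]
termination_by k

/-- What is obtained by opening boxes until a value above `t` is found. -/
theorem le_add_value (hτ : ∀ i, B.IsIndex i (τ i)) {t : ℝ} (k : ℕ) (S : Finset (Fin n))
    (hk : S.card ≤ k) {x : ℝ} (hx : x ∈ Set.Icc 0 B.maxV) (hxt : x ≤ t) :
    t * (1 - B.lowProb τ S t) + B.lowProb τ S t * B.surplus τ S t ≤
      x + B.value (fun x => x) k S x := by
  by_cases hS : ∀ i ∈ S, τ i ≤ t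
  · rw [B.surplus_eq_zero hS, B.lowProb_eq_one hS]
    linarith [B.value_nonneg' (fun x => x) k S x, hx.1]
  push Not at hS
  obtain ⟨i, hi, hti⟩ := hS
  have hpos := Finset.card_pos.2 ⟨i, hi⟩
  obtain ⟨k, rfl⟩ : ∃ l, k = l + 1 := ⟨k - 1, by omega⟩
  set R := t * (1 - B.lowProb τ (S.erase i) t) +
    B.lowProb τ (S.erase i) t * B.surplus τ (S.erase i) t with hR
  have ih : ∀ y ∈ Set.Icc 0 B.maxV, y ≤ t → R ≤ y + B.value (fun x => x) k (S.erase i) y :=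
    fun y hy hyt => le_add_value hτ k (S.erase i)
      (by rw [Finset.card_erase_of_mem hi]; omega) hy hyt
  have hval := B.actionValue_le_value (fun x => x) k S x (probe_mem_legalActions.2 hi)
  -- A value above `t` raises the state by `t - x` plus the excess over `t`; if `v ≤ t`, the
  -- guarantee `t` is replaced by the inductive bound `R`.
  obtain ⟨h1, h2⟩ := B.integral_low_split hτ i t (t - x) (R - t)
  have hle := integral_mono_ae h1
    (B.integrable_probe (D := fun x => x) measurable_id (fun _ h => h) k (S.erase i) hx i) (by
      filter_upwards [B.ae_mem_Icc i] with v hv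
      have h3 := max_sub_eq hti v
      by_cases hvt : min v (τ i) ≤ t
      · have hvt' : v ≤ t := (min_le_iff.1 hvt).resolve_right (not_le.2 hti)
        have h4 := ih _ (B.max_mem_Icc hx hv) (max_le hxt hvt')
        rw [Set.indicator_of_mem (by exact hvt)]
        rw [max_eq_left hvt'] at h3
        linarith
      · have hvt' : t < v := lt_of_lt_of_le (not_le.1 hvt) (min_le_left _ _)
        rw [Set.indicator_of_notMem (by exact hvt)]
        rw [max_eq_right hvt'.le] at h3
        have h4 := B.value_nonneg' (fun x => x) k (S.erase i) (max x v)
        have h5 := le_max_right x v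
        linarith)
  rw [h2] at hle
  replace hle := hle.trans hval
  rw [B.surplus_eq_add_erase τ hi, B.lowProb_eq_mul_erase τ hi]
  have hQ : (B.dist i).real {v | min v (τ i) ≤ t} * B.lowProb τ (S.erase i) t ≤ 1 := by
    rw [← B.lowProb_eq_mul_erase τ hi]
    exact B.lowProb_le_one τ S t
  have hf : 0 ≤ ∫ v, max (min v (τ i) - t) 0 ∂B.dist i :=
    integral_nonneg fun _ => le_max_right _ _
  have h6 := mul_le_mul_of_nonneg_right hQ hf
  rw [hR] at hle
  linarith
termination_by k

/-- A transition that increases the state cannot increase the value. -/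
theorem value_le_value_id {D : ℝ → ℝ} (hD : Measurable D)
    (hmem : ∀ x ∈ Set.Icc 0 B.maxV, D x ∈ Set.Icc 0 B.maxV) (hle : ∀ x, x ≤ D x) (k : ℕ)
    (S : Finset (Fin n)) {x I : ℝ} (hx : x ∈ Set.Icc 0 B.maxV) (hI : I ∈ Set.Icc 0 B.maxV)
    (hxI : x ≤ I) : B.value D k S I ≤ B.value (fun x => x) k S x := by
  induction k generalizing S x I with
  | zero => exact le_rfl
  | succ k ih =>
    refine B.value_succ_le (B.value_nonneg' _ _ _ _) (fun i hi => ?_) fun i hi => ?_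
    · have := B.actionValue_le_value (fun x => x) k S x (take_mem_legalActions.2 hi)
      simp only [actionValue] at this
      linarith
    · refine le_trans ?_
        (B.actionValue_le_value (fun x => x) k S x (probe_mem_legalActions.2 hi))
      refine integral_mono_ae (B.integrable_probe hD hmem k _ hI i)
        (B.integrable_probe (D := fun x => x) measurable_id (fun _ h => h) k _ hx i) ?_
      filter_upwards [B.ae_mem_Icc i] with v hv
      have hxv := max_le_max hxI (le_refl v)
      have h1 := ih (S.erase i) (B.max_mem_Icc hx hv) (hmem _ (B.max_mem_Icc hI hv))
        (hxv.trans (hle _))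
      -- The improvement brought by `v` decreases in the state.
      have h2 : max I v - I ≤ max x v - x := by grind
      linarith

/-- Taking box `i` at once is an admissible first action. -/
theorem mean_le_opt (i : Fin n) : B.mean i ≤ B.opt := by
  obtain ⟨k, rfl⟩ : ∃ k, n = k + 1 := ⟨n - 1, by have := i.pos; omega⟩
  rw [opt_eq_value]
  have := B.actionValue_le_value (fun x => x) k Finset.univ 0
    (take_mem_legalActions.2 (Finset.mem_univ i))
  simpa [actionValue] using this

/-- The loss bound spreads from the large states, in which the transition rounds, to all states. -/
theorem value_id_le_value_add {D : ℝ → ℝ} (hD : Measurable D)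
    (hmem : ∀ x ∈ Set.Icc 0 B.maxV, D x ∈ Set.Icc 0 B.maxV) {t δ : ℝ} (hδ : 0 ≤ δ)
    (hDt : ∀ x < t, D x = x)
    (hlarge : ∀ k S x, S.card ≤ k → x ∈ Set.Icc 0 B.maxV → t ≤ x →
      B.value (fun x => x) k S x ≤ B.value D k S (D x) + δ)
    (k : ℕ) (S : Finset (Fin n)) (hk : S.card ≤ k) {x : ℝ} (hx : x ∈ Set.Icc 0 B.maxV) :
    B.value (fun x => x) k S x ≤ B.value D k S (D x) + δ := by
  induction k generalizing S x with
  | zero => simpa [value] using hδ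
  | succ k ih =>
    -- `hlarge` compares the whole remaining games, so `δ` is paid once, on entering the large
    -- states, and not at each opening.
    rcases le_or_gt t x with htx | hxt
    · exact hlarge _ S x hk hx htx
    rw [hDt x hxt]
    refine B.value_succ_le (add_nonneg (B.value_nonneg' _ _ _ _) hδ) (fun i hi => ?_)
      fun i hi => ?_
    · have := B.actionValue_le_value D k S x (take_mem_legalActions.2 hi)
      simp only [actionValue] at this
      linarith
    · have h1 := B.integrable_probe hD hmem k (S.erase i) hx i
      have hle := integral_mono_ae
        (B.integrable_probe (D := fun x => x) measurable_id (fun _ h => h) k (S.erase i) hx i)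
        (h1.add (integrable_const δ)) (by
          filter_upwards [B.ae_mem_Icc i] with v hv
          have := ih (S.erase i) (by rw [Finset.card_erase_of_mem hi]; omega)
            (B.max_mem_Icc hx hv)
          simp only [Pi.add_apply]
          linarith)
      refine hle.trans ?_
      rw [integral_add' h1 (integrable_const δ)]
      have := B.actionValue_le_value D k S x (probe_mem_legalActions.2 hi)
      simp only [actionValue] at this
      simpa using this

/-- In a large state, rounding costs at most `3 ε · OPT`. -/
theorem value_id_le_value_roundUp {ε θ : ℝ} {m : ℕ} {p : ℕ → ℝ} (hτ : ∀ i, B.IsIndex i (τ i))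
    (hp : B.IsDiscretization τ ε θ m p) (hopt : 0 < B.opt) (hε : 0 < ε) (hε' : ε ≤ 1 / 2)
    (hθ : B.opt / ε ≤ θ)
    (hmem : ∀ x ∈ Set.Icc 0 B.maxV, roundUp m p x ∈ Set.Icc 0 B.maxV) (k : ℕ)
    (S : Finset (Fin n)) (x : ℝ) (hk : S.card ≤ k) (hx : x ∈ Set.Icc 0 B.maxV) (hxθ : θ ≤ x) :
    B.value (fun x => x) k S x ≤ B.value (roundUp m p) k S (roundUp m p x) + 3 * ε * B.opt := by
  have hD : Measurable (roundUp m p) := (monotone_roundUp hp.one_le hp.strictMono).measurable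
  have hθ' : B.opt ≤ ε * θ := by
    rw [div_le_iff₀ hε] at hθ
    linarith
  have hθ0 : 0 < θ := lt_of_lt_of_le (div_pos hopt hε) hθ
  have hoptθ : B.opt ≤ θ := by nlinarith
  have hbasic := B.le_add_value hτ n Finset.univ (by simp) (t := θ)
    (x := 0) ⟨le_rfl, B.maxV_nonneg⟩ hθ0.le
  rw [← B.opt_eq_value, zero_add] at hbasic
  have hQ1 := B.lowProb_le_one τ Finset.univ θ
  have hQ0 := B.lowProb_nonneg τ Finset.univ θ
  have hF0 := B.surplus_nonneg τ Finset.univ θ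
  -- Drop `Q · F(θ) ≥ 0` from `hbasic` and use `OPT ≤ ε θ`.
  have hQ : 1 - ε ≤ B.lowProb τ Finset.univ θ := by
    have : θ * (1 - B.lowProb τ Finset.univ θ) ≤ θ * ε := by
      nlinarith [mul_nonneg hQ0 hF0]
    linarith [le_of_mul_le_mul_left this hθ0]
  -- Drop the other term instead: `Q · F(θ) ≤ OPT`, and `Q ≥ 1/2` because `ε ≤ 1/2`.
  have hF : B.surplus τ Finset.univ θ ≤ 2 * B.opt := by
    have h1 : 0 ≤ θ * (1 - B.lowProb τ Finset.univ θ) :=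
      mul_nonneg hθ0.le (by linarith)
    nlinarith
  obtain ⟨j, hj1, hjm, hDx, hxj, hmin⟩ := exists_roundUp_eq hp.one_le hp.strictMono
    (hp.first.trans_le hxθ) (hx.2.trans_eq hp.last.symm)
  have hpj : p j ∈ Set.Icc 0 B.maxV := hDx ▸ hmem x hx
  have hupper := B.value_le_surplus hτ k S hx
    fun i => (B.mean_le_opt i).trans (hoptθ.trans hxθ)
  have hdrop : B.surplus τ S x ≤ B.surplus τ S (p j) + ε * B.opt := by
    -- Either `x = θ` and nothing is rounded, or `x` lies between consecutive points, whose drop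
    -- bounds the loss.
    rcases eq_or_lt_of_le hj1 with rfl | hj
    · have : p 1 = x := le_antisymm (hp.first.trans_le hxθ) hxj
      rw [this]
      linarith [mul_pos hε hopt]
    · obtain ⟨i, rfl⟩ : ∃ i, j = i + 1 := ⟨j - 1, by omega⟩
      have h1 := hp.drop_lt i (by omega) (by omega)
      have h2 := B.surplus_antitone τ S (hmin i (by omega) (by omega)).le
      have h3 := B.surplus_drop_mono τ (Finset.subset_univ S)
        (hp.strictMono i (by omega) (by omega)).le
      linarith
  have hlower := B.lowProb_mul_surplus_le_value hτ hD hmem hpj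
    (roundUp_point hp.one_le hp.strictMono hj1 hjm) k S hk
  have hθj : θ ≤ p j := hxθ.trans hxj
  have hQS : 1 - ε ≤ B.lowProb τ S (p j) :=
    hQ.trans ((B.lowProb_mono τ _ hθj).trans (B.lowProb_anti τ (Finset.subset_univ S) _))
  have hFS : B.surplus τ S (p j) ≤ 2 * B.opt :=
    (B.surplus_mono τ (Finset.subset_univ S) _).trans ((B.surplus_antitone τ _ hθj).trans hF)
  have hFS0 := B.surplus_nonneg τ S (p j)
  rw [hDx]
  -- `(1 - ε) F ≥ F - 2 ε · OPT`; with the `ε · OPT` from `hdrop` the loss is `3 ε · OPT`.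
  have h1 := mul_le_mul_of_nonneg_right hQS hFS0
  have h2 := mul_le_mul_of_nonneg_left hFS hε.le
  linarith

end PNOI

theorem mainTheorem8 :
    ∃ C : ℝ, 0 < C ∧
      ∀ (n : ℕ) (B : PNOI n) (ε θ : ℝ), 0 < ε →
        B.opt / ε ≤ θ → θ ≤ 2 * B.opt / ε →
        ∀ τ : Fin n → ℝ, (∀ i, B.IsIndex i (τ i)) →
        ∀ (m : ℕ) (p : ℕ → ℝ), B.IsDiscretization τ ε θ m p →
          B.optL (PNOI.roundUp m p) ≤ B.opt ∧
            (1 - C * ε) * B.opt ≤ B.optL (PNOI.roundUp m p) := by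
  refine ⟨3, by norm_num, ?_⟩
  intro n B ε θ hε hθ _ τ hτ m p hp
  have hD : Measurable (PNOI.roundUp m p) :=
    (PNOI.monotone_roundUp hp.one_le hp.strictMono).measurable
  have hmem : ∀ x ∈ Set.Icc 0 B.maxV, PNOI.roundUp m p x ∈ Set.Icc 0 B.maxV := fun x hx =>
    ⟨hx.1.trans (PNOI.le_roundUp hp.one_le hp.strictMono x),
      (PNOI.roundUp_le hp.one_le hp.strictMono (hx.2.trans_eq hp.last.symm)).trans_eq hp.last⟩
  have h0 : (0 : ℝ) ∈ Set.Icc 0 B.maxV := ⟨le_rfl, B.maxV_nonneg⟩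
  have hopt : 0 ≤ B.opt := B.opt_eq_value ▸ B.value_nonneg' _ _ _ _
  have hoptL : 0 ≤ B.optL (PNOI.roundUp m p) :=
    B.optL_eq_value hD hmem ▸ B.value_nonneg' _ _ _ _
  constructor
  · rw [B.optL_eq_value hD hmem, B.opt_eq_value]
    exact B.value_le_value_id hD hmem (PNOI.le_roundUp hp.one_le hp.strictMono) n _ h0 h0 le_rfl
  rcases hopt.eq_or_lt with h | hpos
  -- If OPT is 0, positivity of `θ` is not available, but the claim is just `0 ≤ OPT^L`.
  · rwa [← h, mul_zero]
  rcases le_or_gt ε (1 / 2) with hε' | hε'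
  · have hθ0 : 0 < θ := lt_of_lt_of_le (div_pos hpos hε) hθ
    have hbelow : ∀ x < θ, PNOI.roundUp m p x = x := fun x hx =>
      PNOI.roundUp_eq_self fun h => absurd (hp.first ▸ h.1) (not_le.2 hx)
    have := B.value_id_le_value_add hD hmem (t := θ) (δ := 3 * ε * B.opt) (by positivity) hbelow
      (B.value_id_le_value_roundUp hτ hp hpos hε hε' hθ hmem) n Finset.univ (by simp) h0
    rw [hbelow 0 hθ0, ← B.opt_eq_value, ← B.optL_eq_value hD hmem] at this
    linarith
  -- For `ε > 1/2` the factor `1 - 3 ε` is negative.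
  · exact le_trans (mul_nonpos_of_nonpos_of_nonneg (by linarith) hopt) hoptL
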